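/- Let $\zeta_2(a,b)=\sum_{0<m<n} m^{-a}n^{-b}$ be the Euler--Zagier double zeta function. The series converges absolutely for $\mathrm{Re}(b)>1$, $\mathrm{Re}(a+b)>2$, and $\zeta_2$ also denotes its meromorphic continuation to $\mathbb{C}^2$, which is holomorphic away from the hyperplanes $b=1$ and $a+b\in\{2,1,0,-2,-4,-6,\dots\}$. Then for every $s\in\mathbb{C}$ with $\mathrm{Re}(s)>1$ and $s\neq 2$, $$\zeta(s)=\sum_{k=0}^{\infty}\bigl[\zeta_2(s-k-2,\,k+2)-\zeta_2(-k,\,s+k)\bigr],$$ where the series on the right converges absolutely and $\zeta$ is the Riemann zeta function. -/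

import Mathlib

/-- The Euler-Zagier double series, evaluated at `p = (a, b)`:
`∑_{0 < n₁ < n₂} n₁ ^ (-a) * n₂ ^ (-b)`, where `n₁ = m + 1` and `n₂ = n₁ + (n + 1)` with
`m, n ≥ 0`. -/
noncomputable def zeta2Series (p : ℂ × ℂ) : ℂ :=
  ∑' q : ℕ × ℕ, 1 / (((q.1 : ℂ) + 1) ^ p.1 * ((q.1 : ℂ) + 1 + ((q.2 : ℂ) + 1)) ^ p.2)

/-- The domain of absolute convergence of the double series. -/
def zeta2ConvergenceDomain : Set (ℂ × ℂ) :=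
  {p | 1 < p.2.re ∧ 2 < (p.1 + p.2).re}

/-- The singular hyperplanes of the double zeta function: `b = 1` and
`a + b ∈ {2, 1, 0, -2, -4, -6, …}`. -/
def zeta2Singularities : Set (ℂ × ℂ) :=
  {p | p.2 = 1 ∨ p.1 + p.2 = 2 ∨ p.1 + p.2 = 1 ∨ ∃ j : ℕ, p.1 + p.2 = -(2 * (j : ℂ))}

/-- An increasing sequence of connected open sets. The one for `r = 0` is the domain of absolute
convergence, and their union is the complement of the singular hyperplanes in `ℂ²`. -/
def zeta2Domain (r : ℕ) : Set (ℂ × ℂ) :=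
  {p | 1 - (r : ℝ) < p.2.re ∧ 2 - (r : ℝ) < (p.1 + p.2).re ∧ p ∉ zeta2Singularities}

/-- `w` is the value at `(a, b)` of a holomorphic continuation of the double series to one of the
connected open sets `zeta2Domain r`. By the identity theorem such a continuation is unique, and
those for different `r` are restrictions of each other. -/
def IsZeta2Value (a b w : ℂ) : Prop :=
  ∃ (r : ℕ) (f : ℂ × ℂ → ℂ),
    DifferentiableOn ℂ f (zeta2Domain r) ∧
    Set.EqOn f zeta2Series zeta2ConvergenceDomain ∧
    (a, b) ∈ zeta2Domain r ∧ f (a, b) = w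

open Classical in
/-- The double zeta function `ζ₂(a, b)`, that is, the meromorphic continuation to `ℂ²` of the
double series, with the convention that it is `0` at the points that have no continued value. -/
noncomputable def zeta2 (a b : ℂ) : ℂ :=
  if h : ∃ w, IsZeta2Value a b w then h.choose else 0

open Complex Filter Topology Set MeasureTheory

/-! Write each term of the double series as `m^(-(a+b)) (m/n)^b`. Both double zeta values in the
`k`-th summand have `a + b = s`, so `k` enters only through a power of the ratio `m/n < 1`.

For `Re s > 2` everything converges absolutely, and the sum over `k` is geometric. The first family
becomes `∑ m^(2-s) / (n (n-m)) = ∑ m^(1-s) H_m`, by partial fractions and telescoping; the second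
becomes `∑ n^(1-s) / (n-m) = ∑ n^(1-s) H_{n-1}`. Since `H_m - H_{m-1} = 1/m`, the difference is
`ζ(s)` (`hasSum_zeta2_sub_zeta2_of_two_lt`).

For `1 < Re s` the summands are continued values. Euler-Maclaurin (`hasSum_zetaRatio_cpow`) gives
the continuation `ζ(a+b-1)/(b-1) - ∑ m^(-(a+b)) fractMellin m b`. In the difference the first parts
give `ζ(s-1)` times a digamma-type series. The remainders are controlled by two bounds, one of order
`1/k` uniformly in `m` and one of order `m^3/k^2`; interpolating between them makes the sum over
`(m, k)` converge locally uniformly (`norm_cpow_mul_fractMellinDiff_le`). The right-hand side is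
thus holomorphic on `Re s > 1`, `s ≠ 2` (`hasSum_zeta2_sub_zeta2`), and the identity theorem
finishes the proof. -/

/-! ### Complex analysis: holomorphy of series and the identity theorem on a punctured half-plane.
-/

/-- A series of holomorphic functions on a ball of a complex normed space that is dominated by a
summable sequence is differentiable at the centre. -/
lemma differentiableAt_tsum_of_summable_norm {E ι : Type*} [NormedAddCommGroup E]
    [NormedSpace ℂ E] {F : ι → E → ℂ} {u : ι → ℝ} {x : E} {r : ℝ} (hr : 0 < r) (hu : Summable u)
    (hd : ∀ i, DifferentiableOn ℂ (F i) (Metric.ball x r))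
    (hb : ∀ i, ∀ y ∈ Metric.ball x r, ‖F i y‖ ≤ u i) :
    DifferentiableAt ℂ (fun y => ∑' i, F i y) x := by
  have hsub : ∀ y ∈ Metric.ball x (r / 2), Metric.ball y (r / 2) ⊆ Metric.ball x r := by
    intro y hy
    apply Metric.ball_subset_ball'
    rw [Metric.mem_ball] at hy
    linarith
  have hx : x ∈ Metric.ball x (r / 2) := Metric.mem_ball_self (by positivity)
  have hsum : Summable fun i => F i x :=
    Summable.of_norm_bounded hu fun i => hb i x (Metric.mem_ball_self hr)
  have key := hasFDerivAt_tsum_of_isPreconnected (𝕜 := ℂ) (f := F)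
    (f' := fun i y => fderiv ℂ (F i) y) (u := fun i => 2 * u i / (r / 2))
    (s := Metric.ball x (r / 2)) (x₀ := x) (x := x)
    ((hu.mul_left 2).div_const _) Metric.isOpen_ball Metric.isPreconnected_ball ?_ ?_ hx hsum hx
  · exact key.differentiableAt
  · intro i y hy
    exact ((hd i).differentiableAt (Metric.isOpen_ball.mem_nhds
      (Metric.ball_subset_ball (by linarith) hy))).hasFDerivAt
  · intro i y hy
    -- Cauchy-type estimate: on the ball of radius `r / 2` about `y` the values of `F i` stay within
    -- `2 * u i` of `F i y`.
    refine norm_fderiv_le_div_of_mapsTo_ball ((hd i).mono (hsub y hy)) (fun z hz => ?_)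
      (by positivity)
    rw [Metric.mem_closedBall, dist_eq_norm]
    have h1 := hb i z (hsub y hy hz)
    have h2 := hb i y (Metric.ball_subset_ball (by linarith) hy)
    linarith [norm_sub_le (F i z) (F i y)]

/-- A half-plane with a point removed is connected. -/
lemma isPreconnected_halfPlane_diff_singleton {c : ℝ} {p : ℂ} (hp : c < p.re) :
    IsPreconnected {z : ℂ | c < z.re ∧ z ≠ p} := by
  -- `g` is a continuous bijection from `ℂ` onto the half-plane with `g q = p`, so the set is the
  -- image of the connected set `ℂ ∖ {q}`.
  let g : ℂ → ℂ := fun w => ((c + Real.exp w.re : ℝ) : ℂ) + (w.im : ℂ) * I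
  have hg : Continuous g := by fun_prop
  have hre : ∀ w, (g w).re = c + Real.exp w.re := fun w => by simp [g, Complex.exp_ofReal_re]
  have him : ∀ w, (g w).im = w.im := fun w => by simp [g]
  let q : ℂ := ⟨Real.log (p.re - c), p.im⟩
  have hq : Real.exp q.re = p.re - c := Real.exp_log (by linarith)
  have h := ((isConnected_compl_singleton_of_one_lt_rank (by simp) q).image g
    hg.continuousOn).isPreconnected
  convert! h using 1
  ext z
  constructor
  · rintro ⟨hz, hzp⟩
    have he : Real.exp (Real.log (z.re - c)) = z.re - c := Real.exp_log (by linarith)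
    refine ⟨⟨Real.log (z.re - c), z.im⟩, ?_, ?_⟩
    · rintro hw
      apply hzp
      have h1 := congrArg Complex.re hw
      have h2 := congrArg Complex.im hw
      simp only [q] at h1 h2
      apply Complex.ext
      · have h3 := congrArg Real.exp h1
        rw [he, Real.exp_log (by linarith)] at h3
        linarith
      · exact h2
    · apply Complex.ext
      · rw [hre]; simp only [he]; ring
      · rw [him]
  · rintro ⟨w, hw, rfl⟩
    refine ⟨by rw [hre]; linarith [Real.exp_pos w.re], fun hwp => hw ?_⟩
    rw [mem_singleton_iff]
    apply Complex.ext
    · apply Real.exp_injective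
      rw [hq, ← hwp, hre]; ring
    · rw [← him, hwp]

lemma isOpen_halfPlane_diff_singleton (c : ℝ) (p : ℂ) :
    IsOpen {z : ℂ | c < z.re ∧ z ≠ p} :=
  (isOpen_lt continuous_const Complex.continuous_re).and isOpen_ne

/-- Two holomorphic functions on a half-plane with a point removed that agree on a smaller
half-plane are equal. -/
lemma eqOn_halfPlane_diff_singleton {f g : ℂ → ℂ} {c d : ℝ} {p : ℂ} (hp : c < p.re)
    (hf : DifferentiableOn ℂ f {z : ℂ | c < z.re ∧ z ≠ p})
    (hg : DifferentiableOn ℂ g {z : ℂ | c < z.re ∧ z ≠ p})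
    (hfg : ∀ z : ℂ, d < z.re → f z = g z) :
    EqOn f g {z : ℂ | c < z.re ∧ z ≠ p} := by
  have ho := isOpen_halfPlane_diff_singleton c p
  let z₀ : ℂ := ((max (max c d) p.re + 1 : ℝ) : ℂ)
  have hz : z₀.re = max (max c d) p.re + 1 := Complex.ofReal_re _
  have h1 := le_max_left (max c d) p.re
  have h2 := le_max_right (max c d) p.re
  have h3 := le_max_left c d
  have h4 := le_max_right c d
  refine (hf.analyticOnNhd ho).eqOn_of_preconnected_of_eventuallyEq (hg.analyticOnNhd ho)
    (isPreconnected_halfPlane_diff_singleton hp) (z₀ := z₀) ⟨by linarith, ?_⟩ ?_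
  · intro h
    have := congrArg Complex.re h
    linarith
  · filter_upwards [(isOpen_lt continuous_const Complex.continuous_re).mem_nhds
      (show d < z₀.re by linarith)] with z hz using hfg z hz

/-! ### Uniqueness of the continued value of the double zeta function. -/

lemma notMem_zeta2Singularities {a b : ℂ} (hb : b ≠ 1) (hab : 1 < (a + b).re)
    (hab2 : a + b ≠ 2) : (a, b) ∉ zeta2Singularities := by
  rintro (h | h | h | ⟨j, h⟩)
  · exact hb h
  · exact hab2 h
  · simp only at h; rw [h] at hab; simp at hab
  · simp only at h; rw [h] at hab
    simp at hab
    have : (0 : ℝ) ≤ j := j.cast_nonneg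
    linarith

lemma mem_zeta2Domain_of_one_le {r : ℕ} (hr : 1 ≤ r) {a b : ℂ} (hb : 0 < b.re) (hb1 : b ≠ 1)
    (hab : 1 < (a + b).re) (hab2 : a + b ≠ 2) : (a, b) ∈ zeta2Domain r := by
  have : (1 : ℝ) ≤ r := by exact_mod_cast hr
  refine ⟨?_, ?_, notMem_zeta2Singularities hb1 hab hab2⟩
  · change 1 - (r : ℝ) < b.re
    linarith
  · change 2 - (r : ℝ) < (a + b).re
    linarith

/-- Where `Re b > 1` and `Re (a + b) > 1`, the double zeta function is given by any holomorphic
continuation of the double series to `zeta2Domain 1`. -/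
lemma zeta2_eq_of_continuation {F : ℂ × ℂ → ℂ} (hF : DifferentiableOn ℂ F (zeta2Domain 1))
    (hFs : EqOn F zeta2Series zeta2ConvergenceDomain) {a b : ℂ} (hb : 1 < b.re)
    (hab : 1 < (a + b).re) (hab2 : a + b ≠ 2) : zeta2 a b = F (a, b) := by
  have hb1 : b ≠ 1 := by rintro rfl; simp at hb
  have hex : ∃ w, IsZeta2Value a b w :=
    ⟨F (a, b), 1, F, hF, hFs, mem_zeta2Domain_of_one_le le_rfl (by linarith) hb1 hab hab2, rfl⟩
  have huniq : ∀ w, IsZeta2Value a b w → w = F (a, b) := by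
    rintro w ⟨r, f, hf, hfs, hmem, rfl⟩
    rcases Nat.eq_zero_or_pos r with rfl | hr
    · obtain ⟨h1, h2, -⟩ := hmem
      have : (a, b) ∈ zeta2ConvergenceDomain := ⟨by simpa using h1, by simpa using h2⟩
      rw [hfs this, hFs this]
    -- Fixing `b` reduces uniqueness to one variable: the slice `a ↦ (a, b)` is a half-plane without
    -- the point `2 - b`, and since `Re b > 1` it meets the convergence domain.
    · have hslice : ∀ z ∈ {z : ℂ | 1 - b.re < z.re ∧ z ≠ 2 - b}, ∀ r : ℕ, 1 ≤ r →
          (z, b) ∈ zeta2Domain r := by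
        rintro z ⟨hz1, hz2⟩ r hr
        refine mem_zeta2Domain_of_one_le hr (by linarith) hb1 ?_ ?_
        · rw [Complex.add_re]; linarith
        · intro h; exact hz2 (by rw [← h]; ring)
      have hlin : Differentiable ℂ fun z : ℂ => (z, b) := by fun_prop
      refine eqOn_halfPlane_diff_singleton (f := fun z => f (z, b)) (g := fun z => F (z, b))
        (c := 1 - b.re) (d := 2 - b.re) (p := 2 - b) (by simp) ?_ ?_ ?_ ⟨?_, ?_⟩
      · exact hf.comp hlin.differentiableOn fun z hz => hslice z hz r hr
      · exact hF.comp hlin.differentiableOn fun z hz => hslice z hz 1 le_rfl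
      · intro z hz
        have : (z, b) ∈ zeta2ConvergenceDomain := by
          refine ⟨hb, ?_⟩
          change 2 < (z + b).re
          rw [Complex.add_re]; linarith
        change f (z, b) = F (z, b)
        rw [hfs this, hFs this]
      · rw [Complex.add_re] at hab; linarith
      · intro h; exact hab2 (by rw [h]; ring)
  rw [zeta2, dif_pos hex]
  exact huniq _ hex.choose_spec

/-! ### The fractional-part remainder and the Euler-Maclaurin formula. -/

/-- The holomorphic function `b ↦ b ∫₁^∞ {m x} x ^ (-b - 1) dx` on `Re b > 0`, the fractional-part
remainder in the Euler-Maclaurin formula for `∑_{n > m} (m / n) ^ b`. -/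
noncomputable def fractMellin (m : ℕ) (b : ℂ) : ℂ :=
  b * ∫ x in Ioi (1 : ℝ), ((Int.fract ((m : ℝ) * x) : ℝ) : ℂ) * (x : ℂ) ^ (-b - 1)

lemma norm_fract_mul_cpow_le (m : ℕ) (b : ℂ) {x : ℝ} (hx : 0 < x) :
    ‖((Int.fract ((m : ℝ) * x) : ℝ) : ℂ) * (x : ℂ) ^ (-b - 1)‖ ≤ x ^ (-b.re - 1) := by
  rw [norm_mul, Complex.norm_real, Complex.norm_cpow_eq_rpow_re_of_pos hx, Real.norm_eq_abs,
    abs_of_nonneg (Int.fract_nonneg _)]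
  simp only [sub_re, neg_re, one_re]
  exact mul_le_of_le_one_left (by positivity) (Int.fract_lt_one _).le

/-- The bound does not depend on `m`; this lets the sum over `m` in the continuation converge for
`Re (a + b) > 1`. -/
lemma norm_fractMellin_le (m : ℕ) {b : ℂ} (hb : 0 < b.re) : ‖fractMellin m b‖ ≤ ‖b‖ / b.re := by
  rw [fractMellin, norm_mul, div_eq_mul_inv]
  gcongr
  have h := norm_integral_le_of_norm_le (μ := volume.restrict (Ioi (1 : ℝ)))
    (f := fun x : ℝ => ((Int.fract ((m : ℝ) * x) : ℝ) : ℂ) * (x : ℂ) ^ (-b - 1))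
    (g := fun x => x ^ (-b.re - 1)) (integrableOn_Ioi_rpow_of_lt (by linarith) one_pos) ?_
  · rw [integral_Ioi_rpow_of_lt (by linarith) one_pos] at h
    refine h.trans_eq ?_
    rw [Real.one_rpow, show -b.re - 1 + 1 = -b.re by ring, neg_div_neg_eq, one_div]
  · filter_upwards [ae_restrict_mem measurableSet_Ioi] with x hx
    exact norm_fract_mul_cpow_le m b (one_pos.trans hx)

lemma measurable_fract_mul_cpow (m : ℕ) (b : ℂ) :
    Measurable fun x : ℝ => ((Int.fract ((m : ℝ) * x) : ℝ) : ℂ) * (x : ℂ) ^ (-b - 1) := by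
  have : Measurable fun x : ℝ => Int.fract ((m : ℝ) * x) :=
    measurable_fract.comp (measurable_const_mul _)
  fun_prop

lemma integrableOn_fract_mul_cpow (m : ℕ) {b : ℂ} (hb : 0 < b.re) :
    IntegrableOn (fun x : ℝ => ((Int.fract ((m : ℝ) * x) : ℝ) : ℂ) * (x : ℂ) ^ (-b - 1))
      (Ioi (1 : ℝ)) := by
  refine Integrable.mono' (integrableOn_Ioi_rpow_of_lt (a := -b.re - 1) (by linarith) one_pos)
    (measurable_fract_mul_cpow m b).aestronglyMeasurable ?_
  filter_upwards [ae_restrict_mem measurableSet_Ioi] with x hx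
  exact norm_fract_mul_cpow_le m b (one_pos.trans hx)

lemma differentiableAt_fractMellin (m : ℕ) {b : ℂ} (hb : 0 < b.re) :
    DifferentiableAt ℂ (fractMellin m) b := by
  let f : ℝ → ℂ := (Ioi (1 : ℝ)).indicator fun x => ((Int.fract ((m : ℝ) * x) : ℝ) : ℂ)
  have hf1 : ∀ x, ‖f x‖ ≤ 1 := by
    intro x
    refine (norm_indicator_le_norm_self _ _).trans ?_
    rw [Complex.norm_real, Real.norm_eq_abs, abs_of_nonneg (Int.fract_nonneg _)]
    exact (Int.fract_lt_one _).le
  have hmeas : Measurable f := by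
    have : Measurable fun x : ℝ => Int.fract ((m : ℝ) * x) :=
      measurable_fract.comp (measurable_const_mul _)
    exact (Complex.measurable_ofReal.comp this).indicator measurableSet_Ioi
  have hH : fractMellin m = fun b => b * mellin f (-b) := by
    ext b
    rw [fractMellin, mellin]
    congr 1
    have : ∀ t : ℝ, (t : ℂ) ^ (-b - 1) • f t = (Ioi (1 : ℝ)).indicator
        (fun x => ((Int.fract ((m : ℝ) * x) : ℝ) : ℂ) * (x : ℂ) ^ (-b - 1)) t := by
      intro t
      by_cases ht : t ∈ Ioi (1 : ℝ)
      · simp only [f, indicator_of_mem ht, smul_eq_mul, mul_comm]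
      · simp only [f, indicator_of_notMem ht, smul_zero]
    simp_rw [this]
    rw [setIntegral_indicator measurableSet_Ioi,
      inter_eq_self_of_subset_right (Ioi_subset_Ioi zero_le_one)]
  rw [hH]
  have hm : DifferentiableAt ℂ (mellin f) (-b) := by
    -- `f` is bounded at infinity, whence `a := 0`. It vanishes near `0`, so any exponent below `Re
    -- (-b)` serves there.
    refine mellin_differentiableAt_of_isBigO_rpow (a := 0) (b := -b.re - 1) ?_ ?_ ?_ ?_ ?_
    · refine LocallyIntegrable.locallyIntegrableOn ?_ _
      exact (locallyIntegrable_const (1 : ℝ)).mono hmeas.aestronglyMeasurable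
        (Eventually.of_forall fun x => by simpa using hf1 x)
    · refine Asymptotics.isBigO_of_le _ fun x => ?_
      simpa using hf1 x
    · simpa using hb
    · refine Asymptotics.IsBigO.of_bound 0 ?_
      filter_upwards [Ioo_mem_nhdsGT (show (0 : ℝ) < 1 by norm_num)] with x hx
      have : x ∉ Ioi (1 : ℝ) := fun h => absurd (mem_Ioi.mp h) (not_lt.mpr hx.2.le)
      simp [f, indicator_of_notMem this]
    · simp
  have hc : DifferentiableAt ℂ (fun z => mellin f (-z)) b :=
    DifferentiableAt.comp (g := mellin f) (f := fun z => -z) b hm differentiableAt_id.fun_neg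
  exact differentiableAt_id.fun_mul hc

/-- The quotient `n₁ / n₂`, where `n₁ = m + 1` and `n₂ = n₁ + (j + 1)`. -/
noncomputable def zetaRatio (m j : ℕ) : ℝ := ((m : ℝ) + 1) / ((m : ℝ) + 1 + ((j : ℝ) + 1))

lemma zetaRatio_pos (m j : ℕ) : 0 < zetaRatio m j := by
  unfold zetaRatio
  positivity

lemma zetaRatio_lt_one (m j : ℕ) : zetaRatio m j < 1 := by
  unfold zetaRatio
  rw [div_lt_one (by positivity)]
  have : (0 : ℝ) ≤ j := j.cast_nonneg
  linarith

lemma sum_Icc_ite_lt (m n : ℕ) :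
    ∑ k ∈ Finset.Icc 1 n, (if m < k then (1 : ℂ) else 0) = ((n - m : ℕ) : ℂ) := by
  rw [Finset.sum_ite, Finset.sum_const_zero, add_zero, Finset.sum_const, nsmul_eq_mul, mul_one]
  congr 1
  have : (Finset.Icc 1 n).filter (fun k => m < k) = Finset.Ioc m n := by
    ext k; simp only [Finset.mem_filter, Finset.mem_Icc, Finset.mem_Ioc]; omega
  rw [this, Nat.card_Ioc]

/-- The Euler-Maclaurin formula for the tail of a Dirichlet series. -/
lemma hasSum_zetaRatio_cpow (m : ℕ) {b : ℂ} (hb : 1 < b.re) :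
    HasSum (fun j => (zetaRatio m j : ℂ) ^ b)
      (((m : ℂ) + 1) / (b - 1) - fractMellin (m + 1) b) := by
  let M : ℕ := m + 1
  have hM : (0 : ℝ) < M := by positivity
  have hb0 : b ≠ 0 := by rintro rfl; simp at hb; linarith
  have hb1 : b - 1 ≠ 0 := by
    intro h; rw [sub_eq_zero.mp h] at hb; simp at hb
  -- The L-series of this indicator is the tail `∑_{n > M} n^(-b)`. Its partial sums are `⌊t⌋ - M`,
  -- where truncated subtraction gives the required `0` for `t ≤ M`; Abel summation turns the tail
  -- into an integral, and `t = M x` rescales it.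
  let f : ℕ → ℂ := fun k => if M < k then 1 else 0
  have hO : (fun n : ℕ => ∑ k ∈ Finset.Icc 1 n, ‖f k‖) =O[atTop] fun n => (n : ℝ) ^ (1 : ℝ) := by
    refine Asymptotics.isBigO_of_le _ fun n => ?_
    rw [Real.norm_eq_abs, abs_of_nonneg (Finset.sum_nonneg fun _ _ => norm_nonneg _),
      Real.rpow_one, Real.norm_eq_abs, Nat.abs_cast]
    calc ∑ k ∈ Finset.Icc 1 n, ‖f k‖ ≤ ∑ k ∈ Finset.Icc 1 n, (1 : ℝ) := by
          refine Finset.sum_le_sum fun k _ => ?_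
          simp only [f]; split_ifs <;> simp
      _ = n := by simp
  have hLs : LSeriesSummable f b := LSeriesSummable_of_sum_norm_bigO hO zero_le_one hb
  have hL := LSeries_eq_mul_integral' f zero_le_one hb hO
  have hint : (∫ t in Ioi (1 : ℝ), (∑ k ∈ Finset.Icc 1 ⌊t⌋₊, f k) * (t : ℂ) ^ (-(b + 1))) =
      ∫ t in Ioi (M : ℝ), ((⌊t⌋₊ - M : ℕ) : ℂ) * (t : ℂ) ^ (-(b + 1)) := by
    simp only [f, sum_Icc_ite_lt]
    refine setIntegral_eq_of_subset_of_forall_sdiff_eq_zero measurableSet_Ioi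
      (Ioi_subset_Ioi (by simp [M])) ?_
    rintro t ⟨-, ht⟩
    have : ⌊t⌋₊ ≤ M := Nat.floor_le_of_le (not_lt.mp ht)
    rw [Nat.sub_eq_zero_of_le this, Nat.cast_zero, zero_mul]
  have hsub : (∫ t in Ioi (M : ℝ), ((⌊t⌋₊ - M : ℕ) : ℂ) * (t : ℂ) ^ (-(b + 1))) =
      (M : ℂ) ^ (-b) * ∫ x in Ioi (1 : ℝ), ((M : ℂ) * (x : ℂ) ^ (-b) -
        (M : ℂ) * (x : ℂ) ^ (-b - 1) - ((Int.fract ((M : ℝ) * x) : ℝ) : ℂ) * (x : ℂ) ^ (-b - 1)) := by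
    have h1 := integral_comp_mul_left_Ioi'
      (fun t : ℝ => ((⌊t⌋₊ - M : ℕ) : ℂ) * (t : ℂ) ^ (-(b + 1))) 1 hM
    rw [mul_one] at h1
    rw [← h1, ← integral_smul, ← integral_const_mul]
    refine setIntegral_congr_fun measurableSet_Ioi fun x hx => ?_
    have hx1 : (1 : ℝ) < x := hx
    have hx0 : (0 : ℝ) < x := by linarith
    have hMx : (M : ℝ) ≤ M * x := by nlinarith
    have hfl : M ≤ ⌊(M : ℝ) * x⌋₊ := Nat.le_floor hMx
    have hfr : ((⌊(M : ℝ) * x⌋₊ - M : ℕ) : ℂ) =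
        (M : ℂ) * x - ((Int.fract ((M : ℝ) * x) : ℝ) : ℂ) - M := by
      rw [Nat.cast_sub hfl]
      have h := Int.floor_add_fract ((M : ℝ) * x)
      have h2 : ((⌊(M : ℝ) * x⌋₊ : ℕ) : ℝ) = (⌊(M : ℝ) * x⌋ : ℝ) :=
        natCast_floor_eq_intCast_floor (by positivity)
      have h3 : ((⌊(M : ℝ) * x⌋₊ : ℕ) : ℝ) = M * x - Int.fract ((M : ℝ) * x) := by
        rw [h2]; linarith
      have h4 := congrArg (fun y : ℝ => (y : ℂ)) h3
      push_cast at h4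
      rw [h4]
    simp only [hfr, Complex.real_smul]
    have hMc : (M : ℂ) ≠ 0 := by exact_mod_cast hM.ne'
    have hxc : (x : ℂ) ≠ 0 := by exact_mod_cast hx0.ne'
    have e1 : ((M * x : ℝ) : ℂ) ^ (-(b + 1)) = (M : ℂ) ^ (-b) / M * (x : ℂ) ^ (-b - 1) := by
      rw [Complex.ofReal_mul, Complex.mul_cpow_ofReal_nonneg hM.le hx0.le,
        show -(b + 1) = -b - 1 by ring, Complex.ofReal_natCast,
        Complex.cpow_sub _ 1 hMc, Complex.cpow_one]
    have e2 : (x : ℂ) ^ (-b) = (x : ℂ) ^ (-b - 1) * x := by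
      rw [Complex.cpow_sub _ 1 hxc, Complex.cpow_one, div_mul_cancel₀ _ hxc]
    rw [e1, e2, Complex.ofReal_natCast]
    field_simp
    ring
  have hi1 : IntegrableOn (fun x : ℝ => (M : ℂ) * (x : ℂ) ^ (-b)) (Ioi 1) :=
    (integrableOn_Ioi_cpow_of_lt (by rw [neg_re]; linarith) one_pos).const_mul _
  have hi2 : IntegrableOn (fun x : ℝ => (M : ℂ) * (x : ℂ) ^ (-b - 1)) (Ioi 1) :=
    (integrableOn_Ioi_cpow_of_lt (by simp; linarith) one_pos).const_mul _
  have hval : b * ∫ x in Ioi (1 : ℝ), ((M : ℂ) * (x : ℂ) ^ (-b) -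
        (M : ℂ) * (x : ℂ) ^ (-b - 1) - ((Int.fract ((M : ℝ) * x) : ℝ) : ℂ) * (x : ℂ) ^ (-b - 1)) =
      (M : ℂ) / (b - 1) - fractMellin M b := by
    have hA := integral_sub (hi1.sub hi2) (integrableOn_fract_mul_cpow M (b := b) (by linarith))
    have hB := integral_sub hi1 hi2
    simp only [Pi.sub_apply] at hA
    rw [hA, hB, integral_const_mul, integral_const_mul,
      integral_Ioi_cpow_of_lt (by rw [neg_re]; linarith) one_pos,
      integral_Ioi_cpow_of_lt (by simp; linarith) one_pos, fractMellin]
    rw [mul_sub, Complex.ofReal_one, Complex.one_cpow, Complex.one_cpow,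
      show -b + 1 = -(b - 1) by ring, show -b - 1 + 1 = -b by ring, neg_div_neg_eq, neg_div_neg_eq]
    congr 1
    field_simp
    ring
  rw [hint, hsub] at hL
  have hMc : (M : ℂ) ≠ 0 := by exact_mod_cast hM.ne'
  have hS : HasSum (fun n => LSeries.term f b n)
      ((M : ℂ) ^ (-b) * ((M : ℂ) / (b - 1) - fractMellin M b)) := by
    rw [← hval, mul_left_comm, ← hL]
    exact hLs.hasSum
  have hzero : ∑ i ∈ Finset.range (M + 1), LSeries.term f b i = 0 := by
    refine Finset.sum_eq_zero fun i hi => ?_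
    have : ¬ M < i := by have := Finset.mem_range.mp hi; omega
    rw [LSeries.term_def]
    simp [f, this]
  have hS2 := (hasSum_nat_add_iff' (M + 1)).mpr hS
  rw [hzero, sub_zero] at hS2
  have hS3 := hS2.mul_left ((M : ℂ) ^ b)
  rw [← mul_assoc, ← Complex.cpow_add _ _ hMc, add_neg_cancel, Complex.cpow_zero, one_mul] at hS3
  convert! hS3 using 1
  · ext j
    rw [LSeries.term_of_ne_zero (by omega), zetaRatio]
    have : M < j + (M + 1) := by omega
    simp only [f, this, if_true]
    have e : (((m : ℝ) + 1) / ((m : ℝ) + 1 + ((j : ℝ) + 1)) : ℝ) =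
        (M : ℝ) * ((j + (M + 1) : ℕ) : ℝ)⁻¹ := by
      simp only [M]; push_cast; rw [div_eq_mul_inv]; congr 2; ring
    rw [e, Complex.ofReal_mul, Complex.mul_cpow_ofReal_nonneg hM.le (by positivity),
      Complex.ofReal_inv, Complex.inv_cpow _ _ ?_, Complex.ofReal_natCast, Complex.ofReal_natCast]
    · ring
    · rw [Complex.ofReal_natCast, Complex.natCast_arg]; exact Real.pi_pos.ne
  · simp [M]

lemma norm_natCast_add_one_cpow (m : ℕ) (z : ℂ) :
    ‖((m : ℂ) + 1) ^ z‖ = ((m : ℝ) + 1) ^ z.re := by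
  rw [← Complex.norm_cpow_eq_rpow_re_of_pos (by positivity)]
  push_cast
  rfl

lemma summable_natCast_add_one_rpow {c : ℝ} (hc : c < -1) :
    Summable fun m : ℕ => ((m : ℝ) + 1) ^ c := by
  have := (summable_nat_add_iff 1).mpr (Real.summable_nat_rpow.mpr hc)
  simpa using this

lemma norm_zetaRatio_cpow (m j : ℕ) (b : ℂ) :
    ‖(zetaRatio m j : ℂ) ^ b‖ = zetaRatio m j ^ b.re :=
  Complex.norm_cpow_eq_rpow_re_of_pos (zetaRatio_pos m j) b

lemma summable_zetaRatio_rpow (m : ℕ) {β : ℝ} (hβ : 1 < β) :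
    Summable fun j => zetaRatio m j ^ β := by
  have := (hasSum_zetaRatio_cpow m (b := (β : ℂ)) (by simpa using hβ)).summable.norm
  simpa only [norm_zetaRatio_cpow, Complex.ofReal_re] using this

/-- For real `β` the remainder in Euler-Maclaurin is at most `|β| / β = 1`. -/
lemma tsum_zetaRatio_rpow_le (m : ℕ) {β : ℝ} (hβ : 1 < β) :
    ∑' j, zetaRatio m j ^ β ≤ ((m : ℝ) + 1) / (β - 1) + 1 := by
  have hβ0 : 0 < β := by linarith
  have h := (hasSum_zetaRatio_cpow m (b := (β : ℂ)) (by simpa using hβ)).tsum_eq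
  have h1 : ∑' j, (zetaRatio m j : ℂ) ^ (β : ℂ) = ((∑' j, zetaRatio m j ^ β : ℝ) : ℂ) := by
    rw [Complex.ofReal_tsum]
    exact tsum_congr fun j => (Complex.ofReal_cpow (zetaRatio_pos m j).le β).symm
  have h2 : ∑' j, zetaRatio m j ^ β ≤ ‖∑' j, (zetaRatio m j : ℂ) ^ (β : ℂ)‖ := by
    rw [h1, Complex.norm_real]; exact Real.le_norm_self _
  refine h2.trans ?_
  rw [h]
  refine (norm_sub_le _ _).trans ?_
  have h3 := norm_fractMellin_le (m + 1) (b := (β : ℂ)) (by simpa using hβ0)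
  rw [Complex.ofReal_re, Complex.norm_real, Real.norm_eq_abs, abs_of_pos hβ0,
    div_self hβ0.ne'] at h3
  refine add_le_add (le_of_eq ?_) h3
  rw [show ((m : ℂ) + 1) / ((β : ℂ) - 1) = ((((m : ℝ) + 1) / (β - 1) : ℝ) : ℂ) by push_cast; rfl,
    Complex.norm_real, Real.norm_eq_abs, abs_of_nonneg]
  exact div_nonneg (by positivity) (by linarith)

/-! ### The explicit continuation of the double zeta function. -/

/-- The meromorphic continuation of the double series to `Re b > 0`, `Re (a + b) > 1`. -/
noncomputable def zeta2Cont (p : ℂ × ℂ) : ℂ :=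
  riemannZeta (p.1 + p.2 - 1) / (p.2 - 1) -
    ∑' m : ℕ, ((m : ℂ) + 1) ^ (-(p.1 + p.2)) * fractMellin (m + 1) p.2

lemma natCast_add_one_ne_zero (m : ℕ) : (m : ℂ) + 1 ≠ 0 := Nat.cast_add_one_ne_zero m

lemma differentiableAt_natCast_add_one_cpow {E : Type*} [NormedAddCommGroup E] [NormedSpace ℂ E]
    (m : ℕ) {f : E → ℂ} {x : E} (hf : DifferentiableAt ℂ f x) :
    DifferentiableAt ℂ (fun y => ((m : ℂ) + 1) ^ f y) x :=
  hf.const_cpow (Or.inl (natCast_add_one_ne_zero m))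

lemma differentiableOn_zeta2Cont : DifferentiableOn ℂ zeta2Cont (zeta2Domain 1) := by
  rintro ⟨a, b⟩ ⟨hb, hab, hns⟩
  refine DifferentiableAt.differentiableWithinAt ?_
  simp only [Nat.cast_one, sub_self] at hb hab
  have hab' : 1 < (a + b).re := by
    have : (a + b).re > 2 - 1 := hab
    linarith
  have hb1 : b - 1 ≠ 0 := fun h => hns (Or.inl (sub_eq_zero.mp h))
  have hab2 : a + b - 1 ≠ 1 := fun h => hns (Or.inr (Or.inl (by linear_combination h)))
  have h1 : DifferentiableAt ℂ (fun p : ℂ × ℂ => riemannZeta (p.1 + p.2 - 1)) (a, b) :=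
    DifferentiableAt.comp (g := riemannZeta) (f := fun p : ℂ × ℂ => p.1 + p.2 - 1) (a, b)
      (differentiableAt_riemannZeta hab2) (by fun_prop)
  have h2 : DifferentiableAt ℂ (fun p : ℂ × ℂ => p.2 - 1) (a, b) := by fun_prop
  have h3 : DifferentiableAt ℂ
      (fun p : ℂ × ℂ => riemannZeta (p.1 + p.2 - 1) / (p.2 - 1)) (a, b) := by
    simp only [div_eq_mul_inv]
    exact h1.fun_mul (DifferentiableAt.fun_inv h2 hb1)
  refine h3.fun_sub ?_
  set η := (a + b).re - 1 with hη
  have hη0 : 0 < η := by linarith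
  -- In the sup metric both coordinates move by less than `r`, so `a + b` moves by less than `2 * r
  -- ≤ η / 2` and `Re (a + b)` stays above `1 + η / 2`.
  let r := min (b.re / 2) (η / 4)
  have hr : 0 < r := lt_min (by linarith) (by linarith)
  have hr1 : r ≤ b.re / 2 := min_le_left _ _
  have hr2 : r ≤ η / 4 := min_le_right _ _
  have hball : ∀ y ∈ Metric.ball (a, b) r, b.re / 2 < y.2.re ∧ 1 + η / 2 < (y.1 + y.2).re ∧
      ‖y.2‖ ≤ ‖b‖ + b.re / 2 := by
    rintro ⟨y, z⟩ hy
    rw [Metric.mem_ball, Prod.dist_eq, max_lt_iff, dist_eq_norm, dist_eq_norm] at hy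
    obtain ⟨hy1, hy2⟩ := hy
    have e1 := (abs_le.mp (abs_re_le_norm (y - a))).1
    have e2 := (abs_le.mp (abs_re_le_norm (z - b))).1
    have e3 := norm_sub_norm_le z b
    simp only [sub_re] at e1 e2
    simp only at hy1 hy2
    simp only [add_re] at hη ⊢
    refine ⟨by linarith, by linarith, by linarith⟩
  refine differentiableAt_tsum_of_summable_norm hr
    (u := fun m : ℕ => ((m : ℝ) + 1) ^ (-(1 + η / 2)) * ((‖b‖ + b.re / 2) / (b.re / 2)))
    ((summable_natCast_add_one_rpow (by linarith)).mul_right _) ?_ ?_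
  · intro m y hy
    obtain ⟨hy1, -, -⟩ := hball y hy
    refine DifferentiableAt.differentiableWithinAt ?_
    refine (differentiableAt_natCast_add_one_cpow m (by fun_prop)).fun_mul ?_
    exact DifferentiableAt.comp (g := fractMellin (m + 1)) (f := fun p : ℂ × ℂ => p.2) y
      (differentiableAt_fractMellin _ (by linarith)) (by fun_prop)
  · intro m y hy
    obtain ⟨hy1, hy2, hy3⟩ := hball y hy
    rw [norm_mul, norm_natCast_add_one_cpow, neg_re]
    have hm : (1 : ℝ) ≤ (m : ℝ) + 1 := by simp
    refine mul_le_mul (Real.rpow_le_rpow_of_exponent_le hm (by linarith)) ?_ (norm_nonneg _)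
      (by positivity)
    refine (norm_fractMellin_le _ (by linarith)).trans ?_
    gcongr

/-- In this form `a` enters only through `a + b`, which is the same for both double zeta values in a
summand of the theorem. -/
lemma zeta2Series_term_eq (a b : ℂ) (m j : ℕ) :
    1 / (((m : ℂ) + 1) ^ a * ((m : ℂ) + 1 + ((j : ℂ) + 1)) ^ b) =
      ((m : ℂ) + 1) ^ (-(a + b)) * (zetaRatio m j : ℂ) ^ b := by
  have hm := natCast_add_one_ne_zero m
  have h1 : (zetaRatio m j : ℂ) ^ b =
      ((m : ℂ) + 1) ^ b / ((m : ℂ) + 1 + ((j : ℂ) + 1)) ^ b := by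
    have e : zetaRatio m j = ((m + 1 : ℕ) : ℝ) * (((m + 1 + (j + 1) : ℕ) : ℝ)⁻¹ : ℝ) := by
      rw [zetaRatio, div_eq_mul_inv]; push_cast; rfl
    rw [e, Complex.ofReal_mul, Complex.mul_cpow_ofReal_nonneg (by positivity) (by positivity),
      Complex.ofReal_inv, Complex.inv_cpow _ _ ?_, Complex.ofReal_natCast, Complex.ofReal_natCast,
      div_eq_mul_inv]
    · push_cast; rfl
    · rw [Complex.ofReal_natCast, Complex.natCast_arg]; exact Real.pi_pos.ne
  rw [h1, neg_add, Complex.cpow_add _ _ hm, Complex.cpow_neg, Complex.cpow_neg]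
  have h2 : ((m : ℂ) + 1) ^ b ≠ 0 := by simp [Complex.cpow_eq_zero_iff, hm]
  field_simp

lemma norm_zeta2_term (s b : ℂ) (m j : ℕ) :
    ‖((m : ℂ) + 1) ^ (-s) * (zetaRatio m j : ℂ) ^ b‖ =
      ((m : ℝ) + 1) ^ (-s.re) * zetaRatio m j ^ b.re := by
  rw [norm_mul, norm_natCast_add_one_cpow, norm_zetaRatio_cpow, neg_re]

/-- The inner sum over `j` is `O(m + 1)`, which costs one power and explains the condition `2 <
s.re`. -/
lemma summable_zeta2_term {s b : ℂ} (hb : 1 < b.re) (hs : 2 < s.re) :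
    Summable fun q : ℕ × ℕ => ((q.1 : ℂ) + 1) ^ (-s) * (zetaRatio q.1 q.2 : ℂ) ^ b := by
  refine Summable.of_norm ?_
  simp_rw [norm_zeta2_term]
  rw [summable_prod_of_nonneg]
  swap
  · intro q
    have := (zetaRatio_pos q.1 q.2).le
    simp only [Pi.zero_apply]
    positivity
  refine ⟨fun m => ?_, ?_⟩
  · exact (summable_zetaRatio_rpow m hb).mul_left (((m : ℝ) + 1) ^ (-s.re))
  simp only [tsum_mul_left]
  refine Summable.of_nonneg_of_le (fun m => ?_) (fun m => ?_)
    ((summable_natCast_add_one_rpow (c := -s.re + 1) (by linarith)).mul_right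
      (1 / (b.re - 1) + 1))
  · exact mul_nonneg (by positivity)
      (tsum_nonneg fun j => Real.rpow_nonneg (zetaRatio_pos m j).le _)
  · have h := tsum_zetaRatio_rpow_le m hb
    rw [Real.rpow_add_one (by positivity), mul_assoc]
    gcongr
    refine h.trans ?_
    have : (1 : ℝ) ≤ (m : ℝ) + 1 := by simp
    rw [mul_add, mul_one, mul_one_div]
    linarith

lemma summable_fractMellin {s b : ℂ} (hb : 0 < b.re) (hs : 1 < s.re) :
    Summable fun m : ℕ => ((m : ℂ) + 1) ^ (-s) * fractMellin (m + 1) b := by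
  refine Summable.of_norm_bounded
    ((summable_natCast_add_one_rpow (c := -s.re) (by linarith)).mul_right (‖b‖ / b.re)) fun m => ?_
  rw [norm_mul, norm_natCast_add_one_cpow, neg_re]
  gcongr
  exact norm_fractMellin_le _ hb

lemma hasSum_natCast_add_one_cpow {s : ℂ} (hs : 1 < s.re) :
    HasSum (fun m : ℕ => ((m : ℂ) + 1) ^ (-s)) (riemannZeta s) := by
  rw [zeta_eq_tsum_one_div_nat_add_one_cpow hs]
  have h : (fun m : ℕ => ((m : ℂ) + 1) ^ (-s)) = fun m : ℕ => 1 / ((m : ℂ) + 1) ^ s := by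
    ext m; rw [Complex.cpow_neg, one_div]
  rw [← h]
  refine (Summable.of_norm ?_).hasSum
  simp_rw [norm_natCast_add_one_cpow, neg_re]
  exact summable_natCast_add_one_rpow (by linarith)

lemma eqOn_zeta2Cont_zeta2Series : EqOn zeta2Cont zeta2Series zeta2ConvergenceDomain := by
  rintro ⟨a, b⟩ ⟨hb, hab⟩
  simp only at hb hab
  have hm := fun m : ℕ => natCast_add_one_ne_zero m
  rw [zeta2Series, zeta2Cont]
  simp only [zeta2Series_term_eq]
  rw [(summable_zeta2_term hb hab).tsum_prod]
  simp only [tsum_mul_left, (hasSum_zetaRatio_cpow _ hb).tsum_eq]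
  have hz := (hasSum_natCast_add_one_cpow (s := a + b - 1)
    (by rw [sub_re, one_re]; linarith)).div_const (b - 1)
  have hH := (summable_fractMellin (s := a + b) (b := b) (by linarith) (by linarith)).hasSum
  rw [← (hz.sub hH).tsum_eq]
  refine tsum_congr fun m => ?_
  rw [mul_sub, show -(a + b - 1) = -(a + b) + 1 by ring, Complex.cpow_add _ _ (hm m),
    Complex.cpow_one, mul_div_assoc]

lemma zeta2_eq_zeta2Cont {a b : ℂ} (hb : 1 < b.re) (hab : 1 < (a + b).re) (hab2 : a + b ≠ 2) :
    zeta2 a b = zeta2Cont (a, b) :=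
  zeta2_eq_of_continuation differentiableOn_zeta2Cont eqOn_zeta2Cont_zeta2Series hb hab hab2

/-! ### Decay in `k` of the remainder differences. -/

/-- Cauchy's estimate on the circle of radius `Re b / 2`, where `‖z‖ / Re z ≤ 3 ‖b‖ / Re b`. -/
lemma norm_deriv_fractMellin_le (m : ℕ) {b : ℂ} (hb : 0 < b.re) :
    ‖deriv (fractMellin m) b‖ ≤ 6 * ‖b‖ / b.re ^ 2 := by
  have hre : ∀ z ∈ Metric.closedBall b (b.re / 2), b.re / 2 ≤ z.re ∧ ‖z‖ ≤ 3 / 2 * ‖b‖ := by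
    intro z hz
    rw [Metric.mem_closedBall, dist_eq_norm] at hz
    have e1 := (abs_le.mp (abs_re_le_norm (z - b))).1
    have e2 := norm_sub_norm_le z b
    have e3 := (le_abs_self _).trans (abs_re_le_norm b)
    rw [sub_re] at e1
    exact ⟨by linarith, by linarith⟩
  have h := norm_deriv_le_of_forall_mem_sphere_norm_le (f := fractMellin m) (c := b)
    (R := b.re / 2) (C := 3 * ‖b‖ / b.re) (by linarith) ?_ ?_
  · refine h.trans_eq ?_
    field_simp
    ring
  · refine DifferentiableOn.diffContOnCl fun z hz => ?_
    rw [closure_ball _ (by linarith)] at hz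
    exact (differentiableAt_fractMellin m
      (by linarith [(hre z hz).1])).differentiableWithinAt
  · intro z hz
    obtain ⟨h1, h2⟩ := hre z (Metric.sphere_subset_closedBall hz)
    refine (norm_fractMellin_le m (by linarith)).trans ?_
    calc ‖z‖ / z.re ≤ (3 / 2 * ‖b‖) / (b.re / 2) := by gcongr
      _ = 3 * ‖b‖ / b.re := by field_simp

/-- The difference of the fractional-part remainders at `s + k` and `k + 2`. -/
noncomputable def fractMellinDiff (m k : ℕ) (s : ℂ) : ℂ :=
  fractMellin (m + 1) (s + k) - fractMellin (m + 1) (k + 2)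

/-- Mean value inequality between `k + 2` and `s + k`: their distance is at most `2 * R`, and the
derivative is at most `6 * R / (k + 1)` on the convex set `S`. The bound is uniform in `m`, but `1 /
k` alone is not summable. -/
lemma norm_fractMellinDiff_le (m k : ℕ) {s : ℂ} {R : ℝ} (hR : 2 ≤ R) (hs : 1 < s.re)
    (hsR : ‖s‖ ≤ R) : ‖fractMellinDiff m k s‖ ≤ 12 * R ^ 2 / ((k : ℝ) + 1) := by
  let S : Set ℂ := {b | (k : ℝ) + 1 ≤ b.re} ∩ Metric.closedBall 0 (k + R)
  have hS : Convex ℝ S := (convex_halfSpace_re_ge _).inter (convex_closedBall _ _)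
  have hk : (0 : ℝ) ≤ k := k.cast_nonneg
  have h := hS.norm_image_sub_le_of_norm_deriv_le (f := fractMellin (m + 1))
    (C := 6 * R / ((k : ℝ) + 1)) (x := (k : ℂ) + 2) (y := s + k) ?_ ?_ ?_ ?_
  · refine h.trans ?_
    rw [show s + k - ((k : ℂ) + 2) = s - 2 by ring]
    have h1 : ‖s - 2‖ ≤ 2 * R := by
      refine (norm_sub_le _ _).trans ?_
      have : ‖(2 : ℂ)‖ = 2 := by simp
      linarith
    calc 6 * R / ((k : ℝ) + 1) * ‖s - 2‖ ≤ 6 * R / ((k : ℝ) + 1) * (2 * R) := by gcongr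
      _ = _ := by ring
  · rintro b ⟨hb, -⟩
    have hb' : (k : ℝ) + 1 ≤ b.re := hb
    exact differentiableAt_fractMellin _ (by linarith)
  · rintro b ⟨hb, hbR⟩
    have hb' : (k : ℝ) + 1 ≤ b.re := hb
    rw [Metric.mem_closedBall, dist_zero_right] at hbR
    refine (norm_deriv_fractMellin_le _ (by linarith)).trans ?_
    have hbR' : ‖b‖ ≤ R * (k + 1) := by nlinarith
    calc 6 * ‖b‖ / b.re ^ 2 ≤ 6 * (R * (k + 1)) / ((k : ℝ) + 1) ^ 2 := by gcongr
      _ = _ := by field_simp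
  · refine ⟨?_, ?_⟩
    · change (k : ℝ) + 1 ≤ ((k : ℂ) + 2).re
      simp
    · rw [Metric.mem_closedBall, dist_zero_right]
      refine (norm_add_le _ _).trans ?_
      simpa using hR
  · refine ⟨?_, ?_⟩
    · change (k : ℝ) + 1 ≤ (s + k).re
      simp; linarith
    · rw [Metric.mem_closedBall, dist_zero_right]
      refine (norm_add_le _ _).trans ?_
      simp; linarith

lemma norm_one_div_sub_one_div_le (k : ℕ) {s : ℂ} {R δ : ℝ} (hR : 2 ≤ R) (hδ : 0 < δ)
    (hδ1 : δ ≤ 1) (hs : 1 + δ ≤ s.re) (hsR : ‖s‖ ≤ R) :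
    ‖1 / ((k : ℂ) + 1) - 1 / (s + k - 1)‖ ≤ 2 * R / δ * (1 / ((k : ℝ) + 1) ^ 2) := by
  have hk : (0 : ℝ) ≤ k := k.cast_nonneg
  have h1 : δ * ((k : ℝ) + 1) ≤ ‖s + k - 1‖ := by
    have h := (le_abs_self _).trans (abs_re_le_norm (s + k - 1))
    simp only [sub_re, add_re, natCast_re, one_re] at h
    nlinarith
  have hpos : 0 < δ * ((k : ℝ) + 1) := by positivity
  have hne : s + k - 1 ≠ 0 := norm_pos_iff.mp (hpos.trans_le h1)
  have h2 : ‖s - 2‖ ≤ 2 * R := by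
    refine (norm_sub_le _ _).trans ?_
    have : ‖(2 : ℂ)‖ = 2 := by simp
    linarith
  have h3 : ‖(k : ℂ) + 1‖ = (k : ℝ) + 1 := by
    rw [show (k : ℂ) + 1 = ((k + 1 : ℕ) : ℂ) by push_cast; rfl, Complex.norm_natCast]
    push_cast; rfl
  rw [show 1 / ((k : ℂ) + 1) - 1 / (s + k - 1) = (s - 2) / (((k : ℂ) + 1) * (s + k - 1)) by
    rw [div_sub_div _ _ (natCast_add_one_ne_zero k) hne]; ring]
  rw [norm_div, norm_mul, h3]
  calc ‖s - 2‖ / (((k : ℝ) + 1) * ‖s + k - 1‖) ≤ 2 * R / (((k : ℝ) + 1) * (δ * ((k : ℝ) + 1))) := by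
        gcongr
    _ = _ := by field_simp

lemma zetaRatio_pow_le (m j k : ℕ) :
    zetaRatio m j ^ k ≤ 4 * ((m : ℝ) + 1) ^ 2 / ((k : ℝ) + 1) ^ 2 := by
  set x : ℝ := (m : ℝ) + 1 with hx
  have hx1 : 1 ≤ x := by simp [hx]
  have hx0 : 0 < x := by linarith
  have h1 : zetaRatio m j ≤ x / (x + 1) := by
    rw [zetaRatio]
    have : (0 : ℝ) ≤ j := j.cast_nonneg
    gcongr
    linarith
  refine (pow_le_pow_left₀ (zetaRatio_pos m j).le h1 k).trans ?_
  -- The binomial expansion of `(1 + 1 / x) ^ k` truncated after the quadratic term, multiplied by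
  -- `x ^ 2`.
  have h2 : ∀ k : ℕ, x ^ 2 + k * x + k * (k - 1) / 2 ≤ x ^ 2 * ((x + 1) / x) ^ k := by
    intro k
    induction k with
    | zero => simp
    | succ k ih =>
      rw [pow_succ ((x + 1) / x), ← mul_assoc]
      refine le_trans ?_ (mul_le_mul_of_nonneg_right ih (by positivity))
      rw [mul_div_assoc', le_div_iff₀ hx0]
      have hk : (0 : ℝ) ≤ k * ((k : ℝ) - 1) / 2 := by
        rcases Nat.eq_zero_or_pos k with rfl | hk
        · simp
        · have : (1 : ℝ) ≤ k := by exact_mod_cast hk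
          exact div_nonneg (mul_nonneg (by linarith) (by linarith)) (by norm_num)
      push_cast
      nlinarith
  have hk : (0 : ℝ) ≤ k := k.cast_nonneg
  have h3 : ((k : ℝ) + 1) ^ 2 ≤ 4 * x ^ 2 * ((x + 1) / x) ^ k := by
    nlinarith [h2 k]
  rw [le_div_iff₀ (by positivity)]
  calc (x / (x + 1)) ^ k * ((k : ℝ) + 1) ^ 2
      ≤ (x / (x + 1)) ^ k * (4 * x ^ 2 * ((x + 1) / x) ^ k) := by gcongr
    _ = 4 * x ^ 2 * (x / (x + 1) * ((x + 1) / x)) ^ k := by rw [mul_pow]; ring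
    _ = 4 * x ^ 2 := by
        rw [div_mul_div_cancel₀ (by positivity), div_self hx0.ne', one_pow, mul_one]

/-- The exponent is split: the part `1 + δ` makes the sum over `j` converge, and the `k`-th power
supplies `1 / (k + 1) ^ 2`. -/
lemma norm_tsum_zetaRatio_cpow_le (m k : ℕ) {z : ℂ} {δ : ℝ} (hδ : 0 < δ)
    (hδ1 : δ ≤ 1) (hz : 1 + δ ≤ z.re) :
    ‖∑' j, (zetaRatio m j : ℂ) ^ (z + k)‖ ≤ 8 / δ * (((m : ℝ) + 1) ^ 3 / ((k : ℝ) + 1) ^ 2) := by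
  have hδ2 : 1 < 1 + δ := by linarith
  have hm : (1 : ℝ) ≤ (m : ℝ) + 1 := by simp
  have hb := tsum_of_norm_bounded (f := fun j => (zetaRatio m j : ℂ) ^ (z + k))
    ((summable_zetaRatio_rpow m hδ2).mul_left
      (4 * ((m : ℝ) + 1) ^ 2 / ((k : ℝ) + 1) ^ 2)).hasSum ?_
  · refine hb.trans ?_
    rw [tsum_mul_left]
    have h1 : ∑' j, zetaRatio m j ^ (1 + δ) ≤ 2 * ((m : ℝ) + 1) / δ := by
      refine (tsum_zetaRatio_rpow_le m hδ2).trans ?_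
      rw [add_sub_cancel_left, le_div_iff₀ hδ, add_mul, div_mul_cancel₀ _ hδ.ne']
      linarith
    calc 4 * ((m : ℝ) + 1) ^ 2 / ((k : ℝ) + 1) ^ 2 * ∑' j, zetaRatio m j ^ (1 + δ)
        ≤ 4 * ((m : ℝ) + 1) ^ 2 / ((k : ℝ) + 1) ^ 2 * (2 * ((m : ℝ) + 1) / δ) := by gcongr
      _ = _ := by ring
  · intro j
    have hpos := zetaRatio_pos m j
    rw [norm_zetaRatio_cpow, add_re, natCast_re, Real.rpow_add hpos, Real.rpow_natCast, mul_comm]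
    exact mul_le_mul (zetaRatio_pow_le m j k)
      (Real.rpow_le_rpow_of_exponent_ge hpos (zetaRatio_lt_one m j).le hz) (by positivity)
      (by positivity)

/-- Euler-Maclaurin is solved for the remainders: the main terms and the tail series each decay like
`1 / k ^ 2`, at the cost of powers of `m`. -/
lemma norm_fractMellinDiff_le' (m k : ℕ) {s : ℂ} {R δ : ℝ} (hR : 2 ≤ R) (hδ : 0 < δ)
    (hδ1 : δ ≤ 1) (hs : 1 + δ ≤ s.re) (hsR : ‖s‖ ≤ R) :
    ‖fractMellinDiff m k s‖ ≤
      (2 * R / δ + 16 / δ) * (((m : ℝ) + 1) ^ 3 / ((k : ℝ) + 1) ^ 2) := by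
  have hk : (0 : ℝ) ≤ k := k.cast_nonneg
  have e1 := (hasSum_zetaRatio_cpow m (b := s + k)
    (by rw [add_re, natCast_re]; linarith)).tsum_eq
  have e2 := (hasSum_zetaRatio_cpow m (b := 2 + k)
    (by rw [add_re, natCast_re]; simp; linarith)).tsum_eq
  have e : fractMellinDiff m k s =
      -(((m : ℂ) + 1) * (1 / ((k : ℂ) + 1) - 1 / (s + k - 1))) +
      (∑' j, (zetaRatio m j : ℂ) ^ (2 + k : ℂ) - ∑' j, (zetaRatio m j : ℂ) ^ (s + k)) := by
    rw [e1, e2, fractMellinDiff, show (2 : ℂ) + k - 1 = k + 1 by ring, add_comm (2 : ℂ)]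
    ring
  have b1 := norm_one_div_sub_one_div_le k hR hδ hδ1 hs hsR
  have b2 := norm_tsum_zetaRatio_cpow_le m k (z := s) hδ hδ1 hs
  have b3 := norm_tsum_zetaRatio_cpow_le m k (z := 2) hδ hδ1 (by simp; linarith)
  have hm : (1 : ℝ) ≤ (m : ℝ) + 1 := by simp
  have b4 : ‖-(((m : ℂ) + 1) * (1 / ((k : ℂ) + 1) - 1 / (s + k - 1)))‖ ≤
      2 * R / δ * (((m : ℝ) + 1) ^ 3 / ((k : ℝ) + 1) ^ 2) := by
    have hn : ‖(m : ℂ) + 1‖ = (m : ℝ) + 1 := by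
      have := norm_natCast_add_one_cpow m 1
      simpa using this
    rw [norm_neg, norm_mul, hn]
    calc ((m : ℝ) + 1) * ‖1 / ((k : ℂ) + 1) - 1 / (s + k - 1)‖
        ≤ ((m : ℝ) + 1) ^ 3 * (2 * R / δ * (1 / ((k : ℝ) + 1) ^ 2)) := by
          gcongr
          exact le_self_pow₀ hm (by norm_num)
      _ = _ := by ring
  rw [e]
  refine (norm_add_le _ _).trans ?_
  refine (add_le_add b4 ((norm_sub_le _ _).trans (add_le_add b3 b2))).trans_eq ?_
  ring

/-- Interpolation of the two bounds for `fractMellinDiff`: for every `ε ∈ [0, 1]` it is dominated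
by a product of powers of `m + 1` and `k + 1`. -/
lemma norm_fractMellinDiff_le_rpow (m k : ℕ) {s : ℂ} {R δ ε : ℝ} (hR : 2 ≤ R) (hδ : 0 < δ)
    (hδ1 : δ ≤ 1) (hs : 1 + δ ≤ s.re) (hsR : ‖s‖ ≤ R) (hε : 0 ≤ ε) (hε1 : ε ≤ 1) :
    ‖fractMellinDiff m k s‖ ≤ (12 * R ^ 2 + (2 * R / δ + 16 / δ)) *
      (((m : ℝ) + 1) ^ (3 * ε) * ((k : ℝ) + 1) ^ (-(1 + ε))) := by
  set K := 12 * R ^ 2 + (2 * R / δ + 16 / δ) with hK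
  set x : ℝ := (m : ℝ) + 1 with hx
  set y : ℝ := (k : ℝ) + 1 with hy
  have hx0 : 0 < x := by positivity
  have hy0 : 0 < y := by positivity
  have hR0 : 0 ≤ R := by linarith
  have hK0 : 0 < K := by positivity
  have h1 : ‖fractMellinDiff m k s‖ ≤ K * y ^ (-1 : ℝ) := by
    refine (norm_fractMellinDiff_le m k hR (by linarith) hsR).trans ?_
    rw [Real.rpow_neg_one, div_eq_mul_inv]
    gcongr
    rw [hK, le_add_iff_nonneg_right]
    positivity
  have h2 : ‖fractMellinDiff m k s‖ ≤ K * (x ^ (3 : ℝ) * y ^ (-2 : ℝ)) := by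
    refine (norm_fractMellinDiff_le' m k hR hδ hδ1 hs hsR).trans ?_
    have e1 : x ^ (3 : ℝ) = x ^ 3 := by exact_mod_cast Real.rpow_natCast x 3
    have e2 : y ^ (2 : ℝ) = y ^ 2 := by exact_mod_cast Real.rpow_natCast y 2
    rw [Real.rpow_neg hy0.le, ← div_eq_mul_inv, e1, e2]
    gcongr
    rw [hK, le_add_iff_nonneg_left]
    positivity
  have h0 := norm_nonneg (fractMellinDiff m k s)
  calc ‖fractMellinDiff m k s‖
      -- The uniform `1 / k` bound is used on the factor with exponent `1 - ε`, the `m ^ 3 / k ^ 2`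
      -- bound on the other.
      = ‖fractMellinDiff m k s‖ ^ (1 - ε) * ‖fractMellinDiff m k s‖ ^ ε := by
        rw [← Real.rpow_add_of_nonneg h0 (by linarith) hε, sub_add_cancel, Real.rpow_one]
    _ ≤ (K * y ^ (-1 : ℝ)) ^ (1 - ε) * (K * (x ^ (3 : ℝ) * y ^ (-2 : ℝ))) ^ ε := by
        gcongr
    _ = K ^ ((1 - ε) + ε) * (x ^ (3 * ε) * y ^ (-1 * (1 - ε) + -2 * ε)) := by
        rw [Real.mul_rpow hK0.le (by positivity), Real.mul_rpow hK0.le (by positivity),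
          Real.mul_rpow (by positivity) (by positivity), ← Real.rpow_mul hy0.le,
          ← Real.rpow_mul hx0.le, ← Real.rpow_mul hy0.le, Real.rpow_add hK0, Real.rpow_add hy0]
        ring
    _ = _ := by
        rw [sub_add_cancel, Real.rpow_one]
        congr 3
        ring

/-- With `ε = δ / 6` interpolation costs only `(m + 1) ^ (δ / 2)`, half of the margin in `Re s ≥ 1 +
δ`, so both exponents stay below `-1`. -/
lemma norm_cpow_mul_fractMellinDiff_le (m k : ℕ) {s : ℂ} {R δ : ℝ} (hR : 2 ≤ R) (hδ : 0 < δ)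
    (hδ1 : δ ≤ 1) (hs : 1 + δ ≤ s.re) (hsR : ‖s‖ ≤ R) :
    ‖((m : ℂ) + 1) ^ (-s) * fractMellinDiff m k s‖ ≤ (12 * R ^ 2 + (2 * R / δ + 16 / δ)) *
      (((m : ℝ) + 1) ^ (-(1 + δ / 2)) * ((k : ℝ) + 1) ^ (-(1 + δ / 6))) := by
  have hm : (1 : ℝ) ≤ (m : ℝ) + 1 := by simp
  have hR0 : 0 ≤ R := by linarith
  have h := norm_fractMellinDiff_le_rpow m k hR hδ hδ1 hs hsR (ε := δ / 6) (by linarith)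
    (by linarith)
  rw [norm_mul, norm_natCast_add_one_cpow, neg_re]
  calc ((m : ℝ) + 1) ^ (-s.re) * ‖fractMellinDiff m k s‖
      ≤ ((m : ℝ) + 1) ^ (-(1 + δ)) * ((12 * R ^ 2 + (2 * R / δ + 16 / δ)) *
        (((m : ℝ) + 1) ^ (3 * (δ / 6)) * ((k : ℝ) + 1) ^ (-(1 + δ / 6)))) := by
        gcongr
    _ = (12 * R ^ 2 + (2 * R / δ + 16 / δ)) *
        ((((m : ℝ) + 1) ^ (-(1 + δ)) * ((m : ℝ) + 1) ^ (3 * (δ / 6))) *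
          ((k : ℝ) + 1) ^ (-(1 + δ / 6))) := by ring
    _ = _ := by
        rw [← Real.rpow_add (by linarith)]
        congr 3
        ring

lemma summable_fractMellinDiff_bound (K : ℝ) {δ : ℝ} (hδ : 0 < δ) :
    Summable fun q : ℕ × ℕ =>
      K * (((q.1 : ℝ) + 1) ^ (-(1 + δ / 2)) * ((q.2 : ℝ) + 1) ^ (-(1 + δ / 6))) := by
  refine Summable.mul_left K ?_
  have h1 := summable_natCast_add_one_rpow (c := -(1 + δ / 2)) (by linarith)
  have h2 := summable_natCast_add_one_rpow (c := -(1 + δ / 6)) (by linarith)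
  exact h1.mul_of_nonneg h2 (fun m => by simp only [Pi.zero_apply]; positivity)
    fun m => by simp only [Pi.zero_apply]; positivity

lemma summable_one_div_natCast_add_one_sq :
    Summable fun k : ℕ => 1 / ((k : ℝ) + 1) ^ 2 := by
  have h := summable_natCast_add_one_rpow (c := -2) (by norm_num)
  refine h.congr fun k => ?_
  rw [Real.rpow_neg (by positivity), one_div]
  congr 1
  exact_mod_cast Real.rpow_natCast ((k : ℝ) + 1) 2

lemma exists_uniform_bounds {s : ℂ} (hs : 1 < s.re) :
    ∃ δ R : ℝ, 0 < δ ∧ δ ≤ 1 ∧ 2 ≤ R ∧ 1 + δ < s.re ∧ ‖s‖ < R := by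
  refine ⟨min 1 ((s.re - 1) / 2), ‖s‖ + 2, lt_min one_pos (by linarith), min_le_left _ _, ?_, ?_,
    by linarith⟩
  · linarith [norm_nonneg s]
  · linarith [min_le_right 1 ((s.re - 1) / 2)]

/-! ### The right-hand side as a holomorphic function of `s`. -/

/-- The digamma-type series `∑ (1 / (k + 1) - 1 / (s + k - 1))`. -/
noncomputable def poleSum (s : ℂ) : ℂ := ∑' k : ℕ, (1 / ((k : ℂ) + 1) - 1 / (s + k - 1))

/-- The double sum of the fractional-part remainders. -/
noncomputable def remainderSum (s : ℂ) : ℂ :=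
  ∑' q : ℕ × ℕ, ((q.1 : ℂ) + 1) ^ (-s) * fractMellinDiff q.1 q.2 s

lemma hasSum_poleSum {s : ℂ} (hs : 1 < s.re) :
    HasSum (fun k : ℕ => 1 / ((k : ℂ) + 1) - 1 / (s + k - 1)) (poleSum s) := by
  obtain ⟨δ, R, hδ, hδ1, hR, hδs, hsR⟩ := exists_uniform_bounds hs
  exact (Summable.of_norm_bounded (summable_one_div_natCast_add_one_sq.mul_left (2 * R / δ))
    fun k => norm_one_div_sub_one_div_le k hR hδ hδ1 hδs.le hsR.le).hasSum

lemma hasSum_remainderSum {s : ℂ} (hs : 1 < s.re) :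
    HasSum (fun q : ℕ × ℕ => ((q.1 : ℂ) + 1) ^ (-s) * fractMellinDiff q.1 q.2 s)
      (remainderSum s) := by
  obtain ⟨δ, R, hδ, hδ1, hR, hδs, hsR⟩ := exists_uniform_bounds hs
  exact (Summable.of_norm_bounded (summable_fractMellinDiff_bound _ hδ) fun q =>
    norm_cpow_mul_fractMellinDiff_le q.1 q.2 hR hδ hδ1 hδs.le hsR.le).hasSum

lemma isOpen_uniform_region (δ R : ℝ) : IsOpen {s : ℂ | 1 + δ < s.re ∧ ‖s‖ < R} :=
  (isOpen_lt continuous_const Complex.continuous_re).and (isOpen_lt continuous_norm continuous_const)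

lemma differentiableAt_poleSum {s : ℂ} (hs : 1 < s.re) : DifferentiableAt ℂ poleSum s := by
  obtain ⟨δ, R, hδ, hδ1, hR, hδs, hsR⟩ := exists_uniform_bounds hs
  have ho := isOpen_uniform_region δ R
  refine (differentiableOn_tsum_of_summable_norm
    (summable_one_div_natCast_add_one_sq.mul_left (2 * R / δ)) (fun k z hz => ?_) ho
    fun k z hz => norm_one_div_sub_one_div_le k hR hδ hδ1 hz.1.le hz.2.le).differentiableAt
      (ho.mem_nhds ⟨hδs, hsR⟩)
  have hne : z + k - 1 ≠ 0 := by
    intro h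
    have h1 := congrArg Complex.re h
    have hz1 := hz.1
    have hk : (0 : ℝ) ≤ k := k.cast_nonneg
    simp only [sub_re, add_re, natCast_re, one_re, zero_re] at h1
    linarith
  have h1 : DifferentiableAt ℂ (fun z : ℂ => z + k - 1) z := by fun_prop
  simp only [one_div]
  exact ((differentiableAt_const _).fun_sub (DifferentiableAt.fun_inv h1 hne)).differentiableWithinAt

lemma differentiableAt_remainderSum {s : ℂ} (hs : 1 < s.re) :
    DifferentiableAt ℂ remainderSum s := by
  obtain ⟨δ, R, hδ, hδ1, hR, hδs, hsR⟩ := exists_uniform_bounds hs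
  have ho := isOpen_uniform_region δ R
  refine (differentiableOn_tsum_of_summable_norm
    (summable_fractMellinDiff_bound _ hδ) (fun q z hz => ?_) ho
    fun q z hz => norm_cpow_mul_fractMellinDiff_le q.1 q.2 hR hδ hδ1 hz.1.le
      hz.2.le).differentiableAt (ho.mem_nhds ⟨hδs, hsR⟩)
  have hk : (0 : ℝ) ≤ q.2 := q.2.cast_nonneg
  have hz1 := hz.1
  have h1 : DifferentiableAt ℂ (fun z => fractMellinDiff q.1 q.2 z) z := by
    refine DifferentiableAt.sub_const ?_ _
    exact DifferentiableAt.comp (g := fractMellin (q.1 + 1)) (f := fun z : ℂ => z + q.2) z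
      (differentiableAt_fractMellin _ (by rw [add_re, natCast_re]; linarith)) (by fun_prop)
  exact ((differentiableAt_natCast_add_one_cpow q.1 (by fun_prop)).fun_mul
    h1).differentiableWithinAt

/-- Both continued values contain the factor `ζ(s - 1)`, divided by `k + 1` and `s + k - 1`; the
remainder sums combine into `fractMellinDiff`, and the double sum is rearranged to put `k` outside.
-/
lemma hasSum_zeta2_sub_zeta2 {s : ℂ} (hs : 1 < s.re) (hs2 : s ≠ 2) :
    HasSum (fun k : ℕ => zeta2 (s - (k : ℂ) - 2) ((k : ℂ) + 2) - zeta2 (-(k : ℂ)) (s + (k : ℂ)))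
      (riemannZeta (s - 1) * poleSum s + remainderSum s) := by
  have h1 := (hasSum_poleSum hs).mul_left (riemannZeta (s - 1))
  have h2 : HasSum (fun k : ℕ => ∑' m : ℕ, ((m : ℂ) + 1) ^ (-s) * fractMellinDiff m k s)
      (remainderSum s) := by
    have h := (Equiv.prodComm ℕ ℕ).hasSum_iff.mpr (hasSum_remainderSum hs)
    exact h.prod_fiberwise fun k => (h.summable.prod_factor k).hasSum
  refine (h1.add h2).congr_fun fun k => ?_
  have hk : (0 : ℝ) ≤ k := k.cast_nonneg
  have e1 : s - (k : ℂ) - 2 + ((k : ℂ) + 2) = s := by ring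
  have e2 : -(k : ℂ) + (s + k) = s := by ring
  have hb1 : 1 < ((k : ℂ) + 2).re := by simp; linarith
  have hb2 : 1 < (s + k).re := by simp; linarith
  rw [zeta2_eq_zeta2Cont hb1 (by rwa [e1]) (by rwa [e1]),
    zeta2_eq_zeta2Cont hb2 (by rwa [e2]) (by rwa [e2])]
  simp only [zeta2Cont, e1, e2, fractMellinDiff, mul_sub]
  rw [(summable_fractMellin (b := s + k) (by linarith) hs).tsum_sub
    (summable_fractMellin (by linarith) hs)]
  rw [show (k : ℂ) + 2 - 1 = k + 1 by ring]
  ring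

/-! ### The region `Re s > 2`: geometric series and harmonic numbers. -/

/-- Summation of geometric series inside an absolutely convergent series. -/
lemma hasSum_tsum_mul_pow {ι : Type*} {c : ι → ℂ} {r : ι → ℝ} (hr0 : ∀ q, 0 ≤ r q)
    (hr1 : ∀ q, r q < 1) (h : Summable fun q => ‖c q / (1 - r q)‖) :
    HasSum (fun k : ℕ => ∑' q, c q * (r q : ℂ) ^ k) (∑' q, c q / (1 - r q)) := by
  have hn : ∀ q, ‖(r q : ℂ)‖ < 1 := fun q => by
    rw [Complex.norm_real, Real.norm_eq_abs, abs_of_nonneg (hr0 q)]; exact hr1 q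
  have hgeo : ∀ q, HasSum (fun k : ℕ => c q * (r q : ℂ) ^ k) (c q / (1 - r q)) := fun q =>
    (hasSum_geometric_of_norm_lt_one (hn q)).mul_left (c q)
  have hgeo' : ∀ q, HasSum (fun k : ℕ => ‖c q * (r q : ℂ) ^ k‖) ‖c q / (1 - r q)‖ := by
    intro q
    have h1 := (hasSum_geometric_of_lt_one (hr0 q) (hr1 q)).mul_left ‖c q‖
    have h2 : ‖(1 : ℂ) - r q‖ = 1 - r q := by
      rw [← Complex.ofReal_one, ← Complex.ofReal_sub, Complex.norm_real, Real.norm_eq_abs,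
        abs_of_pos (by linarith [hr1 q])]
    rw [norm_div, h2, div_eq_mul_inv]
    refine h1.congr_fun fun k => ?_
    rw [norm_mul, norm_pow, Complex.norm_real, Real.norm_eq_abs, abs_of_nonneg (hr0 q)]
  have hs : Summable fun x : ι × ℕ => c x.1 * (r x.1 : ℂ) ^ x.2 := by
    refine Summable.of_norm ?_
    rw [summable_prod_of_nonneg (fun _ => norm_nonneg _)]
    exact ⟨fun q => (hgeo' q).summable, h.congr fun q => (hgeo' q).tsum_eq.symm⟩
  have h1 := (Equiv.prodComm ℕ ι).hasSum_iff.mpr hs.hasSum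
  have h2 := h1.prod_fiberwise fun k => (h1.summable.prod_factor k).hasSum
  rw [hs.tsum_prod' fun q => (hgeo q).summable] at h2
  simpa only [(hgeo _).tsum_eq, Function.comp_apply, Equiv.prodComm_apply, Prod.swap_prod_mk]
    using h2

/-- Induction on the shift: raising `m` by one adds a telescoping series with sum `1 / (m + 1)`. -/
lemma hasSum_one_div_sub_one_div_add (m : ℕ) :
    HasSum (fun j : ℕ => 1 / ((j : ℝ) + 1) - 1 / ((j : ℝ) + 1 + m))
      (∑ i ∈ Finset.range m, 1 / ((i : ℝ) + 1)) := by
  induction m with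
  | zero => simp [hasSum_zero]
  | succ m ih =>
    have h : HasSum (fun j : ℕ => 1 / ((j : ℝ) + 1 + m) - 1 / ((j : ℝ) + 1 + (m + 1)))
        (1 / ((m : ℝ) + 1)) := by
      rw [hasSum_iff_tendsto_nat_of_nonneg]
      · have hsum : ∀ n : ℕ, ∑ j ∈ Finset.range n,
            (1 / ((j : ℝ) + 1 + m) - 1 / ((j : ℝ) + 1 + (m + 1))) =
            1 / ((m : ℝ) + 1) - 1 / ((n : ℝ) + (m + 1)) := by
          intro n
          have := Finset.sum_range_sub' (fun j : ℕ => 1 / ((j : ℝ) + (m + 1))) n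
          rw [Nat.cast_zero, zero_add] at this
          rw [← this]
          refine Finset.sum_congr rfl fun j _ => ?_
          push_cast
          ring
        simp_rw [hsum]
        have ht : Tendsto (fun n : ℕ => 1 / ((n : ℝ) + (m + 1))) atTop (𝓝 0) := by
          refine Tendsto.div_atTop tendsto_const_nhds ?_
          exact tendsto_atTop_add_const_right _ _ tendsto_natCast_atTop_atTop
        simpa using ht.const_sub (1 / ((m : ℝ) + 1))
      · intro j
        rw [sub_nonneg]
        exact one_div_le_one_div_of_le (by positivity) (by linarith)
    rw [Finset.sum_range_succ]
    refine (ih.add h).congr_fun fun j => ?_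
    push_cast
    ring

/-- Complex-valued harmonic numbers. -/
noncomputable def harmonicSum (n : ℕ) : ℂ := ∑ i ∈ Finset.range n, 1 / ((i : ℂ) + 1)

lemma hasSum_one_div_mul (m : ℕ) :
    HasSum (fun j : ℕ => 1 / (((m : ℂ) + 1 + ((j : ℂ) + 1)) * ((j : ℂ) + 1)))
      (harmonicSum (m + 1) / ((m : ℂ) + 1)) := by
  have h := (Complex.hasSum_ofReal.mpr (hasSum_one_div_sub_one_div_add (m + 1))).div_const
    ((m : ℂ) + 1)
  have e : ((∑ i ∈ Finset.range (m + 1), 1 / ((i : ℝ) + 1) : ℝ) : ℂ) = harmonicSum (m + 1) := by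
    rw [harmonicSum]; push_cast; rfl
  rw [e] at h
  refine h.congr_fun fun j => ?_
  have h1 : (j : ℂ) + 1 ≠ 0 := natCast_add_one_ne_zero j
  have h2 : (m : ℂ) + 1 ≠ 0 := natCast_add_one_ne_zero m
  have h3 : (j : ℂ) + 1 + ((m : ℂ) + 1) ≠ 0 := by
    exact_mod_cast (by omega : j + 1 + (m + 1) ≠ 0)
  have h4 : (m : ℂ) + 1 + ((j : ℂ) + 1) ≠ 0 := by rwa [add_comm]
  push_cast
  field_simp
  ring

/-- The common bound for the two rearranged double series. -/
lemma summable_rpow_mul_rpow {ε : ℝ} (hε : 0 < ε) :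
    Summable fun q : ℕ × ℕ => ((q.1 : ℝ) + 1) ^ (-(1 + ε)) * ((q.2 : ℝ) + 1) ^ (-(1 + ε)) := by
  have h1 := summable_natCast_add_one_rpow (c := -(1 + ε)) (by linarith)
  exact h1.mul_of_nonneg h1 (fun m => by simp only [Pi.zero_apply]; positivity)
    fun m => by simp only [Pi.zero_apply]; positivity

lemma rpow_mul_rpow_le_add {x y ε : ℝ} (hx : 0 < x) (hy : 0 < y) (hε : 0 ≤ ε) (hε1 : ε ≤ 1) :
    x ^ (1 - ε) * y ^ ε ≤ x + y := by
  calc x ^ (1 - ε) * y ^ ε ≤ (x + y) ^ (1 - ε) * (x + y) ^ ε := by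
        gcongr <;> linarith
    _ = x + y := by
        rw [← Real.rpow_add (by positivity), sub_add_cancel, Real.rpow_one]

/-- The factor `1 / (x + y)` is shared out as `x ^ (-(1 - ε)) * y ^ (-ε)`, which leaves both
variables with exponent `-(1 + ε)`. -/
lemma rpow_div_add_mul_le {x y ε σ : ℝ} (hx : 1 ≤ x) (hy : 1 ≤ y) (hε : 0 < ε) (hε1 : ε ≤ 1)
    (hσ : 2 + 2 * ε ≤ σ) :
    x ^ (2 - σ) / ((x + y) * y) ≤ x ^ (-(1 + ε)) * y ^ (-(1 + ε)) := by
  have hx0 : 0 < x := by linarith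
  have hy0 : 0 < y := by linarith
  calc x ^ (2 - σ) / ((x + y) * y) ≤ x ^ (-(2 * ε)) / (x ^ (1 - ε) * y ^ ε * y) := by
        gcongr
        · linarith
        · exact rpow_mul_rpow_le_add hx0 hy0 hε.le hε1
    _ = x ^ (-(2 * ε) - (1 - ε)) * y ^ (-(1 + ε)) := by
        rw [Real.rpow_sub hx0 (-(2 * ε)), Real.rpow_neg hy0.le, add_comm 1 ε, Real.rpow_add_one hy0.ne']
        field_simp
    _ = _ := by congr 2; ring

lemma add_rpow_div_le {x y ε σ : ℝ} (hx : 1 ≤ x) (hy : 1 ≤ y) (hε : 0 < ε)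
    (hσ : 2 + 2 * ε ≤ σ) :
    (x + y) ^ (1 - σ) / y ≤ x ^ (-(1 + ε)) * y ^ (-(1 + ε)) := by
  have hx0 : 0 < x := by linarith
  have hy0 : 0 < y := by linarith
  calc (x + y) ^ (1 - σ) / y ≤ (x + y) ^ (-(1 + ε) + -ε) / y := by
        gcongr
        · linarith
        · linarith
    _ = (x + y) ^ (-(1 + ε)) * (x + y) ^ (-ε) / y := by rw [Real.rpow_add (by positivity)]
    _ ≤ x ^ (-(1 + ε)) * y ^ (-ε) / y := by
        gcongr ?_ * ?_ / y
        · exact Real.rpow_le_rpow_of_nonpos hx0 (by linarith) (by linarith)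
        · exact Real.rpow_le_rpow_of_nonpos hy0 (by linarith) (by linarith)
    _ = _ := by
        rw [mul_div_assoc, show -(1 + ε) = -ε - 1 by ring, Real.rpow_sub_one hy0.ne']

lemma one_sub_zetaRatio (m j : ℕ) :
    1 - (zetaRatio m j : ℂ) = ((j : ℂ) + 1) / ((m : ℂ) + 1 + ((j : ℂ) + 1)) := by
  have h4 : (m : ℂ) + 1 + ((j : ℂ) + 1) ≠ 0 := by
    exact_mod_cast (by omega : m + 1 + (j + 1) ≠ 0)
  rw [zetaRatio]
  push_cast
  field_simp
  ring

lemma natCast_add_one_add_natCast_add_one (m j : ℕ) :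
    (m : ℂ) + 1 + ((j : ℂ) + 1) = ((m + j + 1 : ℕ) : ℂ) + 1 := by
  push_cast; ring

lemma cpow_mul_zetaRatio_sq_div (s : ℂ) (m j : ℕ) :
    ((m : ℂ) + 1) ^ (-s) * (zetaRatio m j : ℂ) ^ 2 / (1 - zetaRatio m j) =
      ((m : ℂ) + 1) ^ (2 - s) * (1 / (((m : ℂ) + 1 + ((j : ℂ) + 1)) * ((j : ℂ) + 1))) := by
  have h1 : (j : ℂ) + 1 ≠ 0 := natCast_add_one_ne_zero j
  have h2 : (m : ℂ) + 1 ≠ 0 := natCast_add_one_ne_zero m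
  have h4 : (m : ℂ) + 1 + ((j : ℂ) + 1) ≠ 0 := by
    rw [natCast_add_one_add_natCast_add_one]; exact natCast_add_one_ne_zero _
  have e : (zetaRatio m j : ℂ) = ((m : ℂ) + 1) / ((m : ℂ) + 1 + ((j : ℂ) + 1)) := by
    rw [zetaRatio]; push_cast; rfl
  rw [one_sub_zetaRatio, e, show 2 - s = -s + 2 by ring, Complex.cpow_add _ _ h2,
    Complex.cpow_ofNat]
  field_simp

lemma cpow_mul_zetaRatio_cpow_div (s : ℂ) (m j : ℕ) :
    ((m : ℂ) + 1) ^ (-s) * (zetaRatio m j : ℂ) ^ s / (1 - zetaRatio m j) =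
      ((m : ℂ) + 1 + ((j : ℂ) + 1)) ^ (1 - s) / ((j : ℂ) + 1) := by
  have h1 : (j : ℂ) + 1 ≠ 0 := natCast_add_one_ne_zero j
  have h4 : (m : ℂ) + 1 + ((j : ℂ) + 1) ≠ 0 := by
    rw [natCast_add_one_add_natCast_add_one]; exact natCast_add_one_ne_zero _
  have h := zeta2Series_term_eq 0 s m j
  rw [zero_add, Complex.cpow_zero, one_mul] at h
  rw [← h, one_sub_zetaRatio, Complex.cpow_sub _ _ h4, Complex.cpow_one]
  field_simp

lemma norm_natCast_add_one (m : ℕ) : ‖(m : ℂ) + 1‖ = (m : ℝ) + 1 := by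
  have := norm_natCast_add_one_cpow m 1
  simpa using this

lemma exists_exponent {σ : ℝ} (hσ : 2 < σ) : ∃ ε : ℝ, 0 < ε ∧ ε ≤ 1 ∧ 2 + 2 * ε ≤ σ :=
  ⟨min 1 ((σ - 2) / 2), lt_min one_pos (by linarith), min_le_left _ _,
    by linarith [min_le_right 1 ((σ - 2) / 2)]⟩

lemma summable_norm_first_double_series {s : ℂ} (hs : 2 < s.re) :
    Summable fun q : ℕ × ℕ => ‖((q.1 : ℂ) + 1) ^ (2 - s) *
      (1 / (((q.1 : ℂ) + 1 + ((q.2 : ℂ) + 1)) * ((q.2 : ℂ) + 1)))‖ := by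
  obtain ⟨ε, hε, hε1, hσ⟩ := exists_exponent hs
  refine Summable.of_nonneg_of_le (fun q => norm_nonneg _) (fun q => ?_)
    (summable_rpow_mul_rpow hε)
  refine le_trans (le_of_eq ?_)
    (rpow_div_add_mul_le (x := (q.1 : ℝ) + 1) (y := (q.2 : ℝ) + 1) (by simp) (by simp) hε hε1 hσ)
  rw [mul_one_div, norm_div, norm_mul, natCast_add_one_add_natCast_add_one,
    norm_natCast_add_one_cpow, norm_natCast_add_one, norm_natCast_add_one]
  simp only [sub_re, re_ofNat]
  push_cast
  ring_nf

lemma summable_norm_second_double_series {s : ℂ} (hs : 2 < s.re) :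
    Summable fun q : ℕ × ℕ =>
      ‖((q.1 : ℂ) + 1 + ((q.2 : ℂ) + 1)) ^ (1 - s) / ((q.2 : ℂ) + 1)‖ := by
  obtain ⟨ε, hε, hε1, hσ⟩ := exists_exponent hs
  refine Summable.of_nonneg_of_le (fun q => norm_nonneg _) (fun q => ?_)
    (summable_rpow_mul_rpow hε)
  refine le_trans (le_of_eq ?_)
    (add_rpow_div_le (x := (q.1 : ℝ) + 1) (y := (q.2 : ℝ) + 1) (by simp) (by simp) hε hσ)
  rw [norm_div, natCast_add_one_add_natCast_add_one, norm_natCast_add_one_cpow,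
    norm_natCast_add_one]
  simp only [sub_re, one_re]
  push_cast
  ring_nf

lemma hasSum_first_double_series {s : ℂ} (hs : 2 < s.re) :
    HasSum (fun m : ℕ => ((m : ℂ) + 1) ^ (1 - s) * harmonicSum (m + 1))
      (∑' q : ℕ × ℕ, ((q.1 : ℂ) + 1) ^ (2 - s) *
        (1 / (((q.1 : ℂ) + 1 + ((q.2 : ℂ) + 1)) * ((q.2 : ℂ) + 1)))) := by
  have h := (summable_norm_first_double_series hs).of_norm.hasSum
  refine h.prod_fiberwise fun m => ?_
  have h2 : (m : ℂ) + 1 ≠ 0 := natCast_add_one_ne_zero m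
  have hm := (hasSum_one_div_mul m).mul_left (((m : ℂ) + 1) ^ (2 - s))
  convert! hm using 1
  rw [show 2 - s = 1 - s + 1 by ring, Complex.cpow_add _ _ h2, Complex.cpow_one]
  field_simp

/-- The summand depends on `m + j` except for `1 / (j + 1)`, so summing along antidiagonals produces
harmonic numbers. -/
lemma hasSum_second_double_series {s : ℂ} (hs : 2 < s.re) :
    HasSum (fun n : ℕ => ((n : ℂ) + 1) ^ (1 - s) * harmonicSum n)
      (∑' q : ℕ × ℕ, ((q.1 : ℂ) + 1 + ((q.2 : ℂ) + 1)) ^ (1 - s) / ((q.2 : ℂ) + 1)) := by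
  have h := (summable_norm_second_double_series hs).of_norm.hasSum
  have h1 := (Finset.HasAntidiagonal.sigmaAntidiagonalEquivProd.hasSum_iff.mpr h).sigma
    fun n => hasSum_fintype _
  -- The antidiagonal `n` carries the larger index `n + 2`, so it matches the term `n + 1`; the term
  -- `0` vanishes because `harmonicSum 0 = 0`.
  rw [← hasSum_nat_add_iff' 1]
  simp only [Finset.sum_range_one, harmonicSum, Finset.sum_range_zero, mul_zero, sub_zero]
  refine h1.congr_fun fun n => ?_
  refine Eq.trans ?_ (Finset.sum_coe_sort (Finset.HasAntidiagonal.antidiagonal n)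
    (fun q : ℕ × ℕ => ((q.1 : ℂ) + 1 + ((q.2 : ℂ) + 1)) ^ (1 - s) / ((q.2 : ℂ) + 1))).symm
  have h2 : ∀ q ∈ Finset.HasAntidiagonal.antidiagonal n,
      ((q.1 : ℂ) + 1 + ((q.2 : ℂ) + 1)) ^ (1 - s) / ((q.2 : ℂ) + 1) =
      (((n + 1 : ℕ) : ℂ) + 1) ^ (1 - s) * (1 / ((q.2 : ℂ) + 1)) := by
    intro q hq
    rw [natCast_add_one_add_natCast_add_one, Finset.HasAntidiagonal.mem_antidiagonal.mp hq, mul_one_div]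
  rw [Finset.sum_congr rfl h2, ← Finset.mul_sum,
    ← Finset.Nat.sum_antidiagonal_swap, Finset.Nat.sum_antidiagonal_eq_sum_range_succ_mk]
  rfl

lemma zeta2_eq_tsum {a b : ℂ} (hb : 1 < b.re) (hab : 2 < (a + b).re) :
    zeta2 a b = ∑' q : ℕ × ℕ, ((q.1 : ℂ) + 1) ^ (-(a + b)) * (zetaRatio q.1 q.2 : ℂ) ^ b := by
  have hab2 : a + b ≠ 2 := by intro h; rw [h] at hab; simp at hab
  rw [zeta2_eq_zeta2Cont hb (by linarith) hab2, eqOn_zeta2Cont_zeta2Series ⟨hb, hab⟩, zeta2Series]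
  exact tsum_congr fun q => zeta2Series_term_eq a b q.1 q.2

lemma hasSum_zeta2_sub_zeta2_of_two_lt {s : ℂ} (hs : 2 < s.re) :
    HasSum (fun k : ℕ => zeta2 (s - (k : ℂ) - 2) ((k : ℂ) + 2) - zeta2 (-(k : ℂ)) (s + (k : ℂ)))
      (riemannZeta s) := by
  have hA := hasSum_tsum_mul_pow
    (c := fun q : ℕ × ℕ => ((q.1 : ℂ) + 1) ^ (-s) * (zetaRatio q.1 q.2 : ℂ) ^ 2)
    (r := fun q => zetaRatio q.1 q.2) (fun q => (zetaRatio_pos _ _).le)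
    (fun q => zetaRatio_lt_one _ _)
    (by simpa only [cpow_mul_zetaRatio_sq_div] using summable_norm_first_double_series hs)
  have hB := hasSum_tsum_mul_pow
    (c := fun q : ℕ × ℕ => ((q.1 : ℂ) + 1) ^ (-s) * (zetaRatio q.1 q.2 : ℂ) ^ s)
    (r := fun q => zetaRatio q.1 q.2) (fun q => (zetaRatio_pos _ _).le)
    (fun q => zetaRatio_lt_one _ _)
    (by simpa only [cpow_mul_zetaRatio_cpow_div] using summable_norm_second_double_series hs)
  simp only [cpow_mul_zetaRatio_sq_div] at hA
  simp only [cpow_mul_zetaRatio_cpow_div] at hB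
  have hval := (hasSum_first_double_series hs).sub (hasSum_second_double_series hs)
  have hz := hasSum_natCast_add_one_cpow (s := s) (by linarith)
  -- Consecutive harmonic numbers differ by `1 / (m + 1)`, which leaves exactly the Dirichlet series
  -- of `ζ(s)`.
  have hterm : ∀ m : ℕ, ((m : ℂ) + 1) ^ (1 - s) * harmonicSum (m + 1) -
      ((m : ℂ) + 1) ^ (1 - s) * harmonicSum m = ((m : ℂ) + 1) ^ (-s) := by
    intro m
    have h2 : (m : ℂ) + 1 ≠ 0 := natCast_add_one_ne_zero m
    rw [harmonicSum, harmonicSum, Finset.sum_range_succ, ← mul_sub, add_sub_cancel_left,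
      show 1 - s = -s + 1 by ring, Complex.cpow_add _ _ h2, Complex.cpow_one]
    field_simp
  simp only [hterm] at hval
  rw [hz.unique hval]
  refine (hA.sub hB).congr_fun fun k => ?_
  have hk : (0 : ℝ) ≤ k := k.cast_nonneg
  have e1 : s - (k : ℂ) - 2 + ((k : ℂ) + 2) = s := by ring
  have e2 : -(k : ℂ) + (s + k) = s := by ring
  have hb1 : 1 < ((k : ℂ) + 2).re := by simp; linarith
  have hb2 : 1 < (s + k).re := by simp; linarith
  rw [zeta2_eq_tsum hb1 (by rwa [e1]), zeta2_eq_tsum hb2 (by rwa [e2]), e1, e2]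
  congr 1
  · refine tsum_congr fun q => ?_
    have hne : (zetaRatio q.1 q.2 : ℂ) ≠ 0 := by exact_mod_cast (zetaRatio_pos q.1 q.2).ne'
    rw [add_comm (k : ℂ), Complex.cpow_add _ _ hne, Complex.cpow_ofNat, Complex.cpow_natCast, mul_assoc]
  · refine tsum_congr fun q => ?_
    have hne : (zetaRatio q.1 q.2 : ℂ) ≠ 0 := by exact_mod_cast (zetaRatio_pos q.1 q.2).ne'
    rw [Complex.cpow_add _ _ hne, Complex.cpow_natCast, mul_assoc]

/-! ### Continuation from `Re s > 2` to `Re s > 1`. -/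

/-- `HasSum` in `ℂ` is unconditional, so it includes the absolute convergence of the series. -/
theorem mainTheorem8 (s : ℂ) (hs : 1 < s.re) (hs2 : s ≠ 2) :
    HasSum (fun k : ℕ => zeta2 (s - (k : ℂ) - 2) ((k : ℂ) + 2) - zeta2 (-(k : ℂ)) (s + (k : ℂ)))
      (riemannZeta s) := by
  have hne : ∀ z : ℂ, 1 < z.re → z ≠ 1 := by rintro z hz rfl; simp at hz
  have h : EqOn riemannZeta (fun z => riemannZeta (z - 1) * poleSum z + remainderSum z)
      {z : ℂ | 1 < z.re ∧ z ≠ 2} := by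
    refine eqOn_halfPlane_diff_singleton (d := 2) (by simp) ?_ ?_ fun z hz => ?_
    · rintro z ⟨hz, -⟩
      exact (differentiableAt_riemannZeta (hne z hz)).differentiableWithinAt
    · rintro z ⟨hz, hz2⟩
      refine DifferentiableAt.differentiableWithinAt ?_
      have hz3 : z - 1 ≠ 1 := fun h => hz2 (by linear_combination h)
      have h1 : DifferentiableAt ℂ (fun z => riemannZeta (z - 1)) z :=
        DifferentiableAt.comp (g := riemannZeta) (f := fun z : ℂ => z - 1) z
          (differentiableAt_riemannZeta hz3) (by fun_prop)
      exact (h1.fun_mul (differentiableAt_poleSum hz)).fun_add (differentiableAt_remainderSum hz)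
    · have hz2 : z ≠ 2 := by rintro rfl; simp at hz
      -- For `Re z > 2` the same series has both values as its sum, so they agree there.
      exact (hasSum_zeta2_sub_zeta2_of_two_lt hz).unique
        (hasSum_zeta2_sub_zeta2 (by linarith) hz2)
  rw [h ⟨hs, hs2⟩]
  exact hasSum_zeta2_sub_zeta2 hs hs2
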